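/- Let $\mu$ and $\mu_n$ ($n\in\mathbb N$) be finite signed Borel measures on $\mathbb R$, with distribution functions $F^{(\mu)}(x)=\mu((-\infty,x])$ and $F^{(\mu_n)}(x)=\mu_n((-\infty,x])$, and let $|\mu_n|$ denote the total variation measure of $\mu_n$. We say that - $\mu_n\to\mu$ *vaguely* if $\int f\,d\mu_n\to\int f\,d\mu$ for every continuous $f:\mathbb R\to\mathbb R$ with compact support; - $\mu_n\to\mu$ *basically* if every subsequence $(\mu_{n_k})$ has a further subsequence $(\mu_{n_{k_l}})$ and an at most countable set $S\subset\mathbb R$ (which may depend on the subsequence) such that $F^{(\mu_{n_{k_l}})}(x_1)-F^{(\mu_{n_{k_l}})}(x_2)\to F^{(\mu)}(x_1)-F^{(\mu)}(x_2)$ as $l\to\infty$ for all $x_1,x_2\in\mathbb R\setminus S$; - $\mu_n\to\mu$ *almost basically* if the same holds with "$S$ at most countable" replaced by "$S$ of Lebesgue measure zero"; - $(\mu_n)$ is *locally uniformly bounded in variation* if $\sup_{n}|\mu_n|([-r,r])<\infty$ for every $r\in\mathbb R$. Then the following are equivalent: 1. $\mu_n\to\mu$ vaguely; 2. $\mu_n\to\mu$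 basically, and $(\mu_n)$ is locally uniformly bounded in variation; 3. $\mu_n\to\mu$ almost basically, and $(\mu_n)$ is locally uniformly bounded in variation. Moreover, let $\mu_n^+,\mu_n^-$ be any finite non-negative Borel measures (not necessarily the Hahn–Jordan decomposition) with $\mu_n=\mu_n^+-\mu_n^-$ for all $n$. If $\mu_n\to\mu$ basically or almost basically, and if $\sup_n\mu_n^+([-r,r])<\infty$ for every $r\in\mathbb R$ or $\sup_n\mu_n^-([-r,r])<\infty$ for every $r\in\mathbb R$, then $(\mu_n)$ is locally uniformly bounded in variation and $\mu_n\to\mu$ vaguely. -/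

import Mathlib

open MeasureTheory Filter Topology

/-- The distribution function `x ↦ μ((-∞, x])` of a finite signed Borel measure on `ℝ`. -/
noncomputable def distributionFunction (μ : SignedMeasure ℝ) (x : ℝ) : ℝ :=
  μ (Set.Iic x)

/-- Vague convergence: convergence of the integrals of all continuous functions with compact
support. -/
def ConvergesVaguely (μ : ℕ → SignedMeasure ℝ) (μ' : SignedMeasure ℝ) : Prop :=
  ∀ f : ℝ → ℝ, Continuous f → HasCompactSupport f →
    Tendsto (fun n => ∫ᵛ x, f x ∂<•(μ n)) atTop (𝓝 (∫ᵛ x, f x ∂<•μ'))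

/-- Basic convergence of functions: every subsequence has a further subsequence along which all
differences of values at points outside some at most countable set converge. -/
def FunConvergesBasically (f : ℕ → ℝ → ℝ) (f' : ℝ → ℝ) : Prop :=
  ∀ φ : ℕ → ℕ, StrictMono φ → ∃ ψ : ℕ → ℕ, StrictMono ψ ∧ ∃ S : Set ℝ, S.Countable ∧
    ∀ x₁ ∉ S, ∀ x₂ ∉ S,
      Tendsto (fun l => f (φ (ψ l)) x₁ - f (φ (ψ l)) x₂) atTop (𝓝 (f' x₁ - f' x₂))

/-- Almost basic convergence of functions: the same with an exceptional set of Lebesgue measure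
zero. -/
def FunConvergesAlmostBasically (f : ℕ → ℝ → ℝ) (f' : ℝ → ℝ) : Prop :=
  ∀ φ : ℕ → ℕ, StrictMono φ → ∃ ψ : ℕ → ℕ, StrictMono ψ ∧ ∃ S : Set ℝ, volume S = 0 ∧
    ∀ x₁ ∉ S, ∀ x₂ ∉ S,
      Tendsto (fun l => f (φ (ψ l)) x₁ - f (φ (ψ l)) x₂) atTop (𝓝 (f' x₁ - f' x₂))

/-- Basic convergence of signed measures, that is, of their distribution functions. -/
def ConvergesBasically (μ : ℕ → SignedMeasure ℝ) (μ' : SignedMeasure ℝ) : Prop :=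
  FunConvergesBasically (fun n => distributionFunction (μ n)) (distributionFunction μ')

/-- Almost basic convergence of signed measures, that is, of their distribution functions. -/
def ConvergesAlmostBasically (μ : ℕ → SignedMeasure ℝ) (μ' : SignedMeasure ℝ) : Prop :=
  FunConvergesAlmostBasically (fun n => distributionFunction (μ n)) (distributionFunction μ')

/-- A sequence of nonnegative measures is locally uniformly bounded. -/
def LocallyUniformlyBounded (ν : ℕ → Measure ℝ) : Prop :=
  ∀ r : ℝ, (⨆ n, ν n (Set.Icc (-r) r)) < ⊤

/-- A sequence of signed measures is locally uniformly bounded in variation. -/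
def LocallyUniformlyBoundedInVariation (μ : ℕ → SignedMeasure ℝ) : Prop :=
  LocallyUniformlyBounded (fun n => (μ n).totalVariation)

/-! Vague convergence forces local boundedness by the uniform boundedness principle: for a compactly
supported cutoff `χ`, the functionals `f ↦ ∫ f χ dμ_n` on bounded continuous functions are pointwise
bounded, hence bounded in norm, and the norm dominates `∫ χ d|μ_n|`.

Basic convergence then follows by Helly selection applied to `|μ_n| + |μ'|`: along a subsequence,
all but countably many points have neighbourhoods of eventually small mass, so the indicator of `(a,
b]` with such end points may be replaced by a continuous function.

Conversely, a null set misses a point of every interval. A test function is therefore uniformly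
close to a step function with nodes off `S`, whose integrals converge; local boundedness controls
the error.

For a decomposition, the masses of `(a, b]` under the two parts differ by the bounded increment of
the distribution function, so a bound on one part passes to the other. -/

/-! ### Integrals against signed measures -/

/-- The integral against a signed measure is the difference of the integrals against the parts of
its Jordan decomposition. -/
theorem integral_eq_integral_posPart_sub_integral_negPart (μ : SignedMeasure ℝ) {f : ℝ → ℝ}
    (hf : Integrable f μ.totalVariation) :
    ∫ᵛ x, f x ∂<•μ = ∫ x, f x ∂μ.toJordanDecomposition.posPart
      - ∫ x, f x ∂μ.toJordanDecomposition.negPart := by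
  have hf' := integrable_add_measure.1 hf
  conv_lhs => rw [← μ.toSignedMeasure_toJordanDecomposition]
  rw [JordanDecomposition.toSignedMeasure, VectorMeasure.integral_sub_vectorMeasure,
    VectorMeasure.integral_toSignedMeasure, VectorMeasure.integral_toSignedMeasure]
  · simpa [VectorMeasure.Integrable] using hf'.1
  · simpa [VectorMeasure.Integrable] using hf'.2

theorem abs_integral_sub_integral_le (μ : SignedMeasure ℝ) {f g h : ℝ → ℝ}
    (hf : Integrable f μ.totalVariation) (hg : Integrable g μ.totalVariation)
    (hh : Integrable h μ.totalVariation) (hfg : ∀ x, |f x - g x| ≤ h x) :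
    |∫ᵛ x, f x ∂<•μ - ∫ᵛ x, g x ∂<•μ| ≤ ∫ x, h x ∂μ.totalVariation := by
  have hf' := integrable_add_measure.1 hf
  have hg' := integrable_add_measure.1 hg
  have hh' := integrable_add_measure.1 hh
  rw [integral_eq_integral_posPart_sub_integral_negPart μ hf,
    integral_eq_integral_posPart_sub_integral_negPart μ hg, SignedMeasure.totalVariation,
    integral_add_measure hh'.1 hh'.2]
  have h1 : |∫ x, (f x - g x) ∂μ.toJordanDecomposition.posPart| ≤
      ∫ x, h x ∂μ.toJordanDecomposition.posPart := by
    rw [← Real.norm_eq_abs]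
    exact norm_integral_le_of_norm_le hh'.1 (Eventually.of_forall hfg)
  have h2 : |∫ x, (f x - g x) ∂μ.toJordanDecomposition.negPart| ≤
      ∫ x, h x ∂μ.toJordanDecomposition.negPart := by
    rw [← Real.norm_eq_abs]
    exact norm_integral_le_of_norm_le hh'.2 (Eventually.of_forall hfg)
  rw [integral_sub hf'.1 hg'.1] at h1
  rw [integral_sub hf'.2 hg'.2] at h2
  rw [abs_le] at *
  constructor <;> linarith [h1.1, h1.2, h2.1, h2.2]

theorem integral_indicator_const_signedMeasure (μ : SignedMeasure ℝ) {s : Set ℝ}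
    (hs : MeasurableSet s) (c : ℝ) :
    ∫ᵛ x, s.indicator (fun _ => c) x ∂<•μ = c * μ s := by
  rw [integral_eq_integral_posPart_sub_integral_negPart μ
    ((integrable_const c).indicator hs), integral_indicator_const _ hs,
    integral_indicator_const _ hs, μ.apply_eq_posPart_real_sub_negPart_real hs]
  simp only [smul_eq_mul]
  ring

theorem distributionFunction_sub (μ : SignedMeasure ℝ) {a b : ℝ} (hab : a ≤ b) :
    distributionFunction μ b - distributionFunction μ a = μ (Set.Ioc a b) := by
  rw [distributionFunction, distributionFunction, ← Set.Iic_union_Ioc_eq_Iic hab,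
    VectorMeasure.of_union (Set.Iic_disjoint_Ioc le_rfl) measurableSet_Iic measurableSet_Ioc]
  ring

theorem locallyUniformlyBounded_iff (ν : ℕ → Measure ℝ) [∀ n, IsFiniteMeasure (ν n)] :
    LocallyUniformlyBounded ν ↔ ∀ r : ℝ, ∃ C, ∀ n, (ν n).real (Set.Icc (-r) r) ≤ C := by
  refine forall_congr' fun r => ⟨fun h => ⟨_, fun n =>
    ENNReal.toReal_mono h.ne (le_iSup (fun n => ν n (Set.Icc (-r) r)) n)⟩, ?_⟩
  rintro ⟨C, hC⟩
  refine (iSup_le fun n => ?_).trans_lt (ENNReal.ofReal_lt_top (r := C))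
  rw [← ofReal_measureReal]
  exact ENNReal.ofReal_le_ofReal (hC n)

theorem integrable_of_continuous_of_abs_le (ν : Measure ℝ) [IsFiniteMeasure ν] {f : ℝ → ℝ}
    (hf : Continuous f) {C : ℝ} (hC : ∀ x, |f x| ≤ C) : Integrable f ν :=
  Integrable.of_bound hf.aestronglyMeasurable C (Eventually.of_forall hC)

theorem integrable_of_continuous_of_hasCompactSupport (ν : Measure ℝ) [IsFiniteMeasure ν]
    {f : ℝ → ℝ} (hf : Continuous f) (hc : HasCompactSupport f) : Integrable f ν :=
  hf.integrable_of_hasCompactSupport hc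

/-! ### Local boundedness in variation of vaguely convergent sequences -/

/-- A bound for the integrals of `f * χ` in terms of the supremum norm of `f` bounds the integral
of `χ` against the total variation. -/
theorem integral_totalVariation_le_of_forall_abs_integral_le (μ : SignedMeasure ℝ) {χ : ℝ → ℝ}
    (hχ : Continuous χ) (hχ01 : ∀ x, χ x ∈ Set.Icc (0 : ℝ) 1) {C : ℝ}
    (hC : ∀ f : ℝ → ℝ, Continuous f → (∀ x, |f x| ≤ 1) → |∫ᵛ x, f x * χ x ∂<•μ| ≤ C) :
    ∫ x, χ x ∂μ.totalVariation ≤ C := by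
  classical
  refine le_of_forall_pos_le_add fun ε hε => ?_
  obtain ⟨A, hA, hpA, hqA⟩ := μ.toJordanDecomposition.mutuallySingular
  have hχ1 : ∀ x, |χ x| ≤ 1 := fun x => abs_le.2 ⟨by linarith [(hχ01 x).1], (hχ01 x).2⟩
  have hχi (ν : Measure ℝ) [IsFiniteMeasure ν] : Integrable χ ν :=
    integrable_of_continuous_of_abs_le ν hχ hχ1
  -- The Hahn sign: `A` is null for the positive part and its complement for the negative part, so
  -- `s dμ = d|μ|`.
  set s : ℝ → ℝ := fun x => if x ∈ A then -1 else 1 with hs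
  have hs1 : ∀ x, |s x| ≤ 1 := fun x => by simp only [hs]; split_ifs <;> simp
  have hsm : Measurable s := Measurable.ite hA measurable_const measurable_const
  have hsi : Integrable s μ.totalVariation :=
    Integrable.of_bound hsm.aestronglyMeasurable 1 (Eventually.of_forall hs1)
  obtain ⟨g, hg, hgi⟩ := hsi.exists_boundedContinuous_integral_sub_le hε
  -- Clipping to `[-1, 1]` makes the approximant admissible for `hC` and, as `s` takes values there,
  -- moves it no further from `s`.
  set k : ℝ → ℝ := fun x => max (-1) (min 1 (g x)) with hk
  have hkc : Continuous k := by fun_prop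
  have hk1 : ∀ x, |k x| ≤ 1 := fun x => by simp only [hk]; grind
  have hsk : ∀ x, |s x - k x| ≤ |s x - g x| := fun x => by
    have := hs1 x
    simp only [hk]; grind
  have hsχ : Integrable (fun x => s x * χ x) μ.totalVariation :=
    Integrable.of_bound (hsm.mul hχ.measurable).aestronglyMeasurable 1 <|
      Eventually.of_forall fun x => by
        rw [norm_mul]; exact mul_le_one₀ (hs1 x) (norm_nonneg _) (hχ1 x)
  have hkχ : Integrable (fun x => k x * χ x) μ.totalVariation :=
    integrable_of_continuous_of_abs_le _ (hkc.mul hχ) (C := 1) fun x => by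
      rw [abs_mul]; exact mul_le_one₀ (hk1 x) (abs_nonneg _) (hχ1 x)
  have h1 : ∫ᵛ x, s x * χ x ∂<•μ = ∫ x, χ x ∂μ.totalVariation := by
    rw [integral_eq_integral_posPart_sub_integral_negPart μ hsχ, SignedMeasure.totalVariation,
      integral_add_measure (hχi _) (hχi _)]
    have hp : ∫ x, s x * χ x ∂μ.toJordanDecomposition.posPart =
        ∫ x, χ x ∂μ.toJordanDecomposition.posPart := by
      refine integral_congr_ae ?_
      filter_upwards [compl_mem_ae_iff.2 hpA] with x hx
      have hx' : x ∉ A := hx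
      simp [hs, hx']
    have hq : ∫ x, s x * χ x ∂μ.toJordanDecomposition.negPart =
        ∫ x, -χ x ∂μ.toJordanDecomposition.negPart := by
      refine integral_congr_ae ?_
      filter_upwards [mem_ae_iff.2 hqA] with x hx
      simp [hs, hx]
    rw [hp, hq, integral_neg]
    ring
  have h2 := abs_integral_sub_integral_le μ hsχ hkχ (hsi.sub hgi).norm fun x => by
    rw [← sub_mul, abs_mul]
    exact (mul_le_of_le_one_right (abs_nonneg _) (hχ1 x)).trans (hsk x)
  have h3 := hC k hkc hk1
  rw [h1] at h2
  have h4 : ∫ x, ‖(s - ⇑g) x‖ ∂μ.totalVariation ≤ ε := hg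
  rw [abs_le] at h2 h3
  linarith [h2.1, h2.2, h3.1, h3.2]

/-- Banach–Steinhaus: each `f * χ` is a test function, so its integrals form a convergent, hence
bounded, sequence. -/
theorem ConvergesVaguely.exists_forall_abs_integral_mul_le {μ : ℕ → SignedMeasure ℝ}
    {μ' : SignedMeasure ℝ} (h : ConvergesVaguely μ μ') {χ : ℝ → ℝ} (hχ : Continuous χ)
    (hχc : HasCompactSupport χ) (hχ01 : ∀ x, χ x ∈ Set.Icc (0 : ℝ) 1) :
    ∃ C, ∀ n, ∀ f : ℝ → ℝ, Continuous f → (∀ x, |f x| ≤ 1) →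
      |∫ᵛ x, f x * χ x ∂<•(μ n)| ≤ C := by
  have hχ1 : ∀ x, |χ x| ≤ 1 := fun x => abs_le.2 ⟨by linarith [(hχ01 x).1], (hχ01 x).2⟩
  have hi (ν : Measure ℝ) [IsFiniteMeasure ν] (f : BoundedContinuousFunction ℝ ℝ) :
      Integrable (fun x => f x * χ x) ν :=
    integrable_of_continuous_of_hasCompactSupport ν (f.continuous.mul hχ) hχc.mul_left
  have hvi (n : ℕ) (f : BoundedContinuousFunction ℝ ℝ) :
      (μ n).Integrable (fun x => f x * χ x) := by
    rw [VectorMeasure.Integrable, ← SignedMeasure.totalVariation_eq_variation]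
    exact hi _ f
  let T : ℕ → BoundedContinuousFunction ℝ ℝ →L[ℝ] ℝ := fun n =>
    LinearMap.mkContinuous
      { toFun := fun f => ∫ᵛ x, f x * χ x ∂<•(μ n)
        map_add' := fun f g => by
          simp only [BoundedContinuousFunction.coe_add, Pi.add_apply, add_mul]
          exact VectorMeasure.integral_fun_add (hvi n f) (hvi n g)
        map_smul' := fun c f => by
          simp only [BoundedContinuousFunction.coe_smul, smul_eq_mul, mul_assoc, RingHom.id_apply]
          exact VectorMeasure.integral_fun_smul _ _ c (fun x => f x * χ x) }
      ((μ n).totalVariation.real Set.univ) fun f => by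
        have := abs_integral_sub_integral_le (μ n) (hi _ f) (integrable_zero ℝ ℝ _)
          (integrable_const ‖f‖) fun x => by
            rw [Pi.zero_apply, sub_zero, abs_mul]
            exact (mul_le_of_le_one_right (abs_nonneg _) (hχ1 x)).trans (f.norm_coe_le_norm x)
        simpa using this
  have hT (n : ℕ) (f : BoundedContinuousFunction ℝ ℝ) : T n f = ∫ᵛ x, f x * χ x ∂<•(μ n) := rfl
  obtain ⟨C, hC⟩ := banach_steinhaus (g := T) fun f => by
    have ht := (h (fun x => f x * χ x) (f.continuous.mul hχ) hχc.mul_left).norm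
    obtain ⟨C, hC⟩ := ht.bddAbove_range
    exact ⟨C, fun n => hC ⟨n, rfl⟩⟩
  refine ⟨C, fun n f hf hf1 => ?_⟩
  let F := BoundedContinuousFunction.ofNormedAddCommGroup f hf 1 hf1
  have hF : ‖F‖ ≤ 1 :=
    BoundedContinuousFunction.norm_ofNormedAddCommGroup_le hf zero_le_one hf1
  have := (T n).le_of_opNorm_le (hC n) F
  rw [hT, Real.norm_eq_abs] at this
  exact this.trans (mul_le_of_le_one_right ((norm_nonneg _).trans (hC n)) hF)

theorem ConvergesVaguely.locallyUniformlyBoundedInVariation {μ : ℕ → SignedMeasure ℝ}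
    {μ' : SignedMeasure ℝ} (h : ConvergesVaguely μ μ') : LocallyUniformlyBoundedInVariation μ := by
  rw [LocallyUniformlyBoundedInVariation, locallyUniformlyBounded_iff]
  intro r
  obtain ⟨χ, h1, -, hc, h01⟩ := exists_continuous_one_zero_of_isCompact
    (isCompact_Icc (a := -r) (b := r)) isClosed_empty (Set.disjoint_empty _)
  obtain ⟨C, hC⟩ := h.exists_forall_abs_integral_mul_le χ.continuous hc h01
  refine ⟨C, fun n => le_trans ?_ (integral_totalVariation_le_of_forall_abs_integral_le (μ n)
    χ.continuous h01 (hC n))⟩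
  rw [← integral_indicator_one measurableSet_Icc]
  refine integral_mono ((integrable_const 1).indicator measurableSet_Icc)
    (integrable_of_continuous_of_hasCompactSupport _ χ.continuous hc) fun x => ?_
  by_cases hx : x ∈ Set.Icc (-r) r
  · simp [hx, h1 hx]
  · simpa [hx] using (h01 x).1

/-! ### From vague to basic convergence -/

theorem measureReal_Iic_sub (ν : Measure ℝ) [IsFiniteMeasure ν] {a b : ℝ} (hab : a ≤ b) :
    ν.real (Set.Iic b) - ν.real (Set.Iic a) = ν.real (Set.Ioc a b) := by
  rw [← Set.Iic_union_Ioc_eq_Iic hab,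
    measureReal_union (Set.Iic_disjoint_Ioc le_rfl) measurableSet_Ioc]
  ring

/-- Helly selection: along a subsequence, a locally uniformly bounded sequence of measures has
uniformly small mass near every point outside a countable set. -/
theorem LocallyUniformlyBounded.exists_subseq_small {ν : ℕ → Measure ℝ}
    [∀ n, IsFiniteMeasure (ν n)] (h : LocallyUniformlyBounded ν) :
    ∃ ψ : ℕ → ℕ, StrictMono ψ ∧ ∃ S : Set ℝ, S.Countable ∧ ∀ x ∉ S, ∀ ε > 0, ∃ δ > 0,
      ∀ᶠ l in atTop, (ν (ψ l)).real (Set.Ioo (x - δ) (x + δ)) ≤ ε := by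
  rw [locallyUniformlyBounded_iff] at h
  choose C hC using h
  -- Normalized at `0`, since only masses of bounded intervals are uniformly controlled.
  let G : ℕ → ℝ → ℝ := fun n x => (ν n).real (Set.Iic x) - (ν n).real (Set.Iic 0)
  have hG (n : ℕ) {x y : ℝ} (hxy : x ≤ y) : G n y - G n x = (ν n).real (Set.Ioc x y) := by
    rw [← measureReal_Iic_sub _ hxy]
    simp only [G]
    ring
  have hGmono (n : ℕ) : Monotone (G n) := fun x y hxy => by
    have := hG n hxy
    linarith [measureReal_nonneg (μ := ν n) (s := Set.Ioc x y)]
  have hGb (n : ℕ) (x : ℝ) : G n x ∈ Set.Icc (-C |x|) (C |x|) := by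
    have hG0 : G n 0 = 0 := by simp [G]
    rcases le_total 0 x with hx | hx
    · have h1 := hG n hx
      have h2 : (ν n).real (Set.Ioc 0 x) ≤ (ν n).real (Set.Icc (-|x|) |x|) :=
        measureReal_mono fun y hy => by
          rw [abs_of_nonneg hx]; exact ⟨by linarith [hy.1], hy.2⟩
      have h3 := hC |x| n
      have h4 := measureReal_nonneg (μ := ν n) (s := Set.Ioc 0 x)
      constructor <;> linarith
    · have h1 := hG n hx
      have h2 : (ν n).real (Set.Ioc x 0) ≤ (ν n).real (Set.Icc (-|x|) |x|) :=
        measureReal_mono fun y hy => by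
          rw [abs_of_nonpos hx]; exact ⟨by linarith [hy.1], by linarith [hy.2]⟩
      have h3 := hC |x| n
      have h4 := measureReal_nonneg (μ := ν n) (s := Set.Ioc x 0)
      constructor <;> linarith
  -- Compactness of a countable product replaces the diagonal argument over the rationals.
  obtain ⟨g, -, ψ, hψ, hg⟩ :=
    (isCompact_univ_pi fun q : ℚ => isCompact_Icc (a := -C |(q : ℝ)|)
      (b := C |(q : ℝ)|)).tendsto_subseq (x := fun n (q : ℚ) => G n q)
      (fun n => Set.mem_univ_pi.2 fun q => hGb n q)
  rw [tendsto_pi_nhds] at hg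
  -- Off the rationals the limit may fail to exist; the limsup is still monotone, hence has
  -- countably many discontinuities.
  let L : ℝ → ℝ := fun x => limsup (fun l => G (ψ l) x) atTop
  have hL (q : ℚ) : L q = g q := (hg q).limsup_eq
  have hLmono : Monotone L := fun x y hxy =>
    limsup_le_limsup (Eventually.of_forall fun l => hGmono (ψ l) hxy)
      (isBoundedUnder_of ⟨-C |x|, fun l => (hGb (ψ l) x).1⟩ :
        IsBoundedUnder (· ≥ ·) atTop _).isCoboundedUnder_le
      (isBoundedUnder_of ⟨C |y|, fun l => (hGb (ψ l) y).2⟩)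
  refine ⟨ψ, hψ, _, hLmono.countable_not_continuousAt, fun x hx ε hε => ?_⟩
  rw [Set.mem_ofPred_eq, not_not, Metric.continuousAt_iff] at hx
  obtain ⟨η, hη, hx⟩ := hx (ε / 2) (by positivity)
  obtain ⟨p, hp1, hp2⟩ := exists_rat_btwn (show x - η < x by linarith)
  obtain ⟨q, hq1, hq2⟩ := exists_rat_btwn (show x < x + η by linarith)
  have hLp := hx (x := p) (by rw [Real.dist_eq, abs_lt]; constructor <;> linarith)
  have hLq := hx (x := q) (by rw [Real.dist_eq, abs_lt]; constructor <;> linarith)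
  rw [Real.dist_eq, abs_lt, hL] at hLp hLq
  refine ⟨min (x - p) (q - x), lt_min (by linarith) (by linarith), ?_⟩
  have hlim := (hg q).sub (hg p)
  filter_upwards [hlim.eventually (gt_mem_nhds (show g q - g p < ε by linarith [hLp.1, hLq.2]))]
    with l hl
  refine (measureReal_mono fun y hy => ?_).trans
    ((hG (ψ l) (x := p) (y := q) (by linarith)).symm.le.trans hl.le)
  have h1 := min_le_left (x - p) (q - x)
  have h2 := min_le_right (x - p) (q - x)
  exact ⟨by linarith [hy.1], by linarith [hy.2]⟩

/-- A continuous approximation of the indicator of `(a, b]` up to the mass of the total variation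
near the end points. -/
theorem exists_continuous_abs_integral_sub_apply_Ioc_le {a b δ : ℝ} (hab : a ≤ b) (hδ : 0 < δ) :
    ∃ f : ℝ → ℝ, Continuous f ∧ HasCompactSupport f ∧ ∀ μ : SignedMeasure ℝ,
      |∫ᵛ x, f x ∂<•μ - μ (Set.Ioc a b)| ≤ μ.totalVariation.real (Set.Ioo (a - δ) (a + δ)) +
        μ.totalVariation.real (Set.Ioo (b - δ) (b + δ)) := by
  obtain ⟨f, h1, h0, hc, h01⟩ := exists_continuous_one_zero_of_isCompact
    (isCompact_Icc (a := a) (b := b)) (isOpen_Ioo (a := a - δ) (b := b + δ)).isClosed_compl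
    (Set.disjoint_compl_right_iff_subset.2 fun x hx => ⟨by linarith [hx.1], by linarith [hx.2]⟩)
  refine ⟨f, f.continuous, hc, fun μ => ?_⟩
  have key := abs_integral_sub_integral_le μ
    (integrable_of_continuous_of_hasCompactSupport _ f.continuous hc)
    ((integrable_const (1 : ℝ)).indicator (measurableSet_Ioc (a := a) (b := b)))
    (((integrable_const (1 : ℝ)).indicator (measurableSet_Ioo (a := a - δ) (b := a + δ))).add
      ((integrable_const (1 : ℝ)).indicator (measurableSet_Ioo (a := b - δ) (b := b + δ))))
    fun x => ?_
  · rw [integral_indicator_const_signedMeasure μ measurableSet_Ioc, one_mul] at key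
    refine key.trans_eq ?_
    rw [integral_add' ((integrable_const _).indicator measurableSet_Ioo)
      ((integrable_const _).indicator measurableSet_Ioo),
      integral_indicator_const _ measurableSet_Ioo, integral_indicator_const _ measurableSet_Ioo,
      smul_eq_mul, smul_eq_mul, mul_one, mul_one]
  · have hx01 := h01 x
    have hx1 : a ≤ x → x ≤ b → f x = 1 := fun h h' => h1 ⟨h, h'⟩
    have hx0 : (x ≤ a - δ ∨ b + δ ≤ x) → f x = 0 := fun h => h0 fun hx => by
      rcases h with h | h
      · exact h.not_gt hx.1
      · exact h.not_gt hx.2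
    -- `f` and the indicator lie in `[0, 1]` and differ only within `δ` of `a` or `b`.
    simp only [Pi.add_apply, Set.indicator_apply, Set.mem_Ioc, Set.mem_Ioo, Set.mem_Icc] at hx01 ⊢
    clear h1 h0 h01
    generalize f x = t at *
    grind

theorem ConvergesVaguely.convergesBasically {μ : ℕ → SignedMeasure ℝ} {μ' : SignedMeasure ℝ}
    (h : ConvergesVaguely μ μ') : ConvergesBasically μ μ' := by
  intro φ hφ
  have hb := h.locallyUniformlyBoundedInVariation
  rw [LocallyUniformlyBoundedInVariation, locallyUniformlyBounded_iff] at hb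
  -- Including `|μ'|` makes the limit measure small near the same points, with the same `δ`.
  have hb' : LocallyUniformlyBounded
      fun n => (μ (φ n)).totalVariation + μ'.totalVariation := by
    rw [locallyUniformlyBounded_iff]
    intro r
    obtain ⟨C, hC⟩ := hb r
    refine ⟨C + μ'.totalVariation.real (Set.Icc (-r) r), fun n => ?_⟩
    rw [measureReal_add_apply]
    gcongr
    exact hC _
  obtain ⟨ψ, hψ, S, hS, hsmall⟩ := hb'.exists_subseq_small
  have key : ∀ a ∉ S, ∀ b ∉ S, a ≤ b → Tendsto (fun l => distributionFunction (μ (φ (ψ l))) b -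
      distributionFunction (μ (φ (ψ l))) a) atTop
      (𝓝 (distributionFunction μ' b - distributionFunction μ' a)) := by
    intro a ha b hb hab
    simp only [distributionFunction_sub _ hab]
    rw [Metric.tendsto_nhds]
    intro ε hε
    obtain ⟨δ₁, hδ₁, h₁⟩ := hsmall a ha (ε / 4) (by positivity)
    obtain ⟨δ₂, hδ₂, h₂⟩ := hsmall b hb (ε / 4) (by positivity)
    obtain ⟨f, hf, hfc, hfb⟩ := exists_continuous_abs_integral_sub_apply_Ioc_le hab
      (lt_min hδ₁ hδ₂)
    have hlim := (h f hf hfc).comp (hφ.comp hψ).tendsto_atTop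
    filter_upwards [h₁, h₂, Metric.tendsto_nhds.1 hlim (ε / 2) (by positivity)] with l hl₁ hl₂ hl
    rw [measureReal_add_apply] at hl₁ hl₂
    have mono (ν : Measure ℝ) [IsFiniteMeasure ν] (x δ : ℝ) (hδ : min δ₁ δ₂ ≤ δ) :
        ν.real (Set.Ioo (x - min δ₁ δ₂) (x + min δ₁ δ₂)) ≤ ν.real (Set.Ioo (x - δ) (x + δ)) :=
      measureReal_mono (Set.Ioo_subset_Ioo (by linarith) (by linarith))
    have e₁ := hfb (μ (φ (ψ l)))
    have e₂ := hfb μ'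
    have m₁ := mono (μ (φ (ψ l))).totalVariation a δ₁ (min_le_left _ _)
    have m₂ := mono (μ (φ (ψ l))).totalVariation b δ₂ (min_le_right _ _)
    have m₃ := mono μ'.totalVariation a δ₁ (min_le_left _ _)
    have m₄ := mono μ'.totalVariation b δ₂ (min_le_right _ _)
    simp only [Function.comp_apply, Real.dist_eq] at hl ⊢
    rw [abs_lt] at *
    rw [abs_le] at e₁ e₂
    constructor <;> linarith [hl.1, hl.2, e₁.1, e₁.2, e₂.1, e₂.2]
  refine ⟨ψ, hψ, S, hS, fun a ha b hb => ?_⟩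
  rcases le_total b a with hab | hab
  · exact key b hb a ha hab
  · simpa using (key a ha b hb hab).neg

/-! ### From almost basic to vague convergence -/

theorem ConvergesBasically.convergesAlmostBasically {μ : ℕ → SignedMeasure ℝ}
    {μ' : SignedMeasure ℝ} (h : ConvergesBasically μ μ') : ConvergesAlmostBasically μ μ' := by
  intro φ hφ
  obtain ⟨ψ, hψ, S, hS, hlim⟩ := h φ hφ
  exact ⟨ψ, hψ, S, hS.measure_zero _, hlim⟩

theorem exists_mem_Ioo_notMem_of_volume_eq_zero {S : Set ℝ} (hS : volume S = 0) {a b : ℝ}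
    (hab : a < b) : ∃ x ∈ Set.Ioo a b, x ∉ S := by
  by_contra! hsub
  have : volume (Set.Ioo a b) = 0 := measure_mono_null hsub hS
  rw [Real.volume_Ioo, ENNReal.ofReal_eq_zero] at this
  linarith

/-- The half-open cells are disjoint, so at each point at most one summand is active; induction adds
one cell at a time. -/
theorem abs_indicator_Ioc_sub_sum_le {f : ℝ → ℝ} {x : ℕ → ℝ} (hx : Monotone x) {ε : ℝ}
    (hf : ∀ i, ∀ y ∈ Set.Ioc (x i) (x (i + 1)), |f y - f (x (i + 1))| ≤ ε) (k : ℕ) (y : ℝ) :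
    |(Set.Ioc (x 0) (x k)).indicator f y - ∑ i ∈ Finset.range k,
      (Set.Ioc (x i) (x (i + 1))).indicator (fun _ => f (x (i + 1))) y| ≤
    (Set.Ioc (x 0) (x k)).indicator (fun _ => ε) y := by
  induction k with
  | zero => simp
  | succ k ih =>
    have h1 := hx (Nat.zero_le k)
    have h2 := hx (Nat.le_succ k)
    have h3 := hf k y
    rw [Finset.sum_range_succ]
    generalize ∑ i ∈ Finset.range k,
      (Set.Ioc (x i) (x (i + 1))).indicator (fun _ => f (x (i + 1))) y = s at *
    simp only [Set.indicator_apply, Set.mem_Ioc, Nat.succ_eq_add_one] at *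
    grind

theorem convergesVaguely_of_tendsto_sub {μ : ℕ → SignedMeasure ℝ} {μ' : SignedMeasure ℝ}
    (hb : LocallyUniformlyBoundedInVariation μ) {S : Set ℝ} (hS : volume S = 0)
    (h : ∀ a ∉ S, ∀ b ∉ S,
      Tendsto (fun n => distributionFunction (μ n) a - distributionFunction (μ n) b) atTop
        (𝓝 (distributionFunction μ' a - distributionFunction μ' b))) :
    ConvergesVaguely μ μ' := by
  intro f hf hfc
  rw [LocallyUniformlyBoundedInVariation, locallyUniformlyBounded_iff] at hb
  obtain ⟨r, hr0, hr⟩ : ∃ r > 0, ∀ y, r < |y| → f y = 0 := by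
    obtain ⟨r, hr0, hr⟩ := hfc.isCompact.isBounded.subset_closedBall_lt 0 0
    refine ⟨r, hr0, fun y hy => image_eq_zero_of_notMem_tsupport fun hy' => ?_⟩
    have := hr hy'
    rw [Metric.mem_closedBall, Real.dist_eq, sub_zero] at this
    linarith
  -- The nodes up to `x k` stay in `[-(r + 2), r + 2]`: they start after `-r - 1` and overshoot `r`
  -- by less than `2 * δ ≤ 2`.
  obtain ⟨C, hC⟩ := hb (r + 2)
  set D := μ'.totalVariation.real (Set.Icc (-(r + 2)) (r + 2)) with hD
  have hC0 : 0 ≤ C := measureReal_nonneg.trans (hC 0)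
  have hD0 : 0 ≤ D := measureReal_nonneg
  rw [Metric.tendsto_nhds]
  intro η hη
  set ε := η / (2 * (C + D + 1)) with hε
  have hε0 : 0 < ε := by positivity
  have hεη : ε * C + ε * D < η / 2 := by
    have : ε * (C + D + 1) = η / 2 := by rw [hε]; field_simp
    nlinarith
  obtain ⟨δ', hδ', hunif⟩ := Metric.uniformContinuous_iff.1 (hfc.uniformContinuous_of_continuous hf)
    ε hε0
  set δ := min (δ' / 2) 1 with hδ
  have hδ0 : 0 < δ := by positivity
  have hδ1 : δ ≤ 1 := min_le_right _ _
  have hδ2 : 2 * δ ≤ δ' := by linarith [min_le_left (δ' / 2) 1]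
  -- One node per cell of length `δ`, so consecutive nodes are less than `2 * δ ≤ δ'` apart.
  have hex (i : ℕ) : ∃ x ∈ Set.Ioo (-r - 1 + i * δ) (-r - 1 + (i + 1) * δ), x ∉ S :=
    exists_mem_Ioo_notMem_of_volume_eq_zero hS (by linarith)
  choose x hxI hxS using hex
  have hxmono : Monotone x := monotone_nat_of_le_succ fun i => by
    have h1 := (hxI i).2
    have h2 := (hxI (i + 1)).1
    push_cast at h2
    linarith
  have hxf (i : ℕ) (y : ℝ) (hy : y ∈ Set.Ioc (x i) (x (i + 1))) : |f y - f (x (i + 1))| ≤ ε := by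
    refine (hunif (a := y) (b := x (i + 1)) ?_).le
    have h1 := (hxI i).1
    have h2 := (hxI (i + 1)).2
    push_cast at h2
    rw [Real.dist_eq, abs_lt]
    constructor <;> linarith [hy.1, hy.2]
  set k := ⌈(2 * r + 1) / δ⌉₊ with hk
  have hk1 : 2 * r + 1 ≤ k * δ := (div_le_iff₀ hδ0).1 (Nat.le_ceil _)
  have hk2 : k * δ < 2 * r + 1 + δ := by
    have := Nat.ceil_lt_add_one (show 0 ≤ (2 * r + 1) / δ by positivity)
    rw [← hk] at this
    calc k * δ < ((2 * r + 1) / δ + 1) * δ := by gcongr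
      _ = _ := by field_simp
  have hx0 : x 0 < -r := by have := (hxI 0).2; push_cast at this; linarith
  have hx0' : -r - 1 < x 0 := by have := (hxI 0).1; push_cast at this; linarith
  have hxk : r < x k := by have := (hxI k).1; linarith
  have hxk' : x k < r + 2 := by have := (hxI k).2; linarith
  have hfind : (Set.Ioc (x 0) (x k)).indicator f = f := by
    rw [Set.indicator_eq_self]
    intro y hy
    by_contra hy'
    refine hy (hr y ?_)
    rw [Set.mem_Ioc, not_and_or, not_lt, not_le] at hy'
    rw [lt_abs]
    rcases hy' with hy' | hy'
    · right; linarith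
    · left; linarith
  let g : ℝ → ℝ := fun y => ∑ i ∈ Finset.range k,
      (Set.Ioc (x i) (x (i + 1))).indicator (fun _ => f (x (i + 1))) y
  have hgi (ν : Measure ℝ) [IsFiniteMeasure ν] : Integrable g ν :=
    integrable_finsetSum _ fun i _ => (integrable_const _).indicator measurableSet_Ioc
  have hgint (ν : SignedMeasure ℝ) : ∫ᵛ y, g y ∂<•ν = ∑ i ∈ Finset.range k, f (x (i + 1)) *
      (distributionFunction ν (x (i + 1)) - distributionFunction ν (x i)) := by
    simp only [g]
    rw [VectorMeasure.integral_finsetSum]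
    · refine Finset.sum_congr rfl fun i _ => ?_
      rw [integral_indicator_const_signedMeasure _ measurableSet_Ioc,
        distributionFunction_sub _ (hxmono (Nat.le_succ i))]
    · intro i _
      rw [VectorMeasure.Integrable, ← SignedMeasure.totalVariation_eq_variation]
      exact (integrable_const _).indicator measurableSet_Ioc
  have happrox (ν : SignedMeasure ℝ) : |∫ᵛ y, f y ∂<•ν - ∫ᵛ y, g y ∂<•ν| ≤
      ε * ν.totalVariation.real (Set.Icc (-(r + 2)) (r + 2)) := by
    refine (abs_integral_sub_integral_le ν
      (integrable_of_continuous_of_hasCompactSupport _ hf hfc) (hgi _)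
      ((integrable_const ε).indicator (measurableSet_Ioc (a := x 0) (b := x k)))
      fun y => ?_).trans ?_
    · have := abs_indicator_Ioc_sub_sum_le hxmono hxf k y
      rwa [hfind] at this
    · rw [integral_indicator_const _ measurableSet_Ioc, smul_eq_mul, mul_comm]
      gcongr
      · exact measure_ne_top _ _
      · exact fun y hy => ⟨by linarith [hy.1], by linarith [hy.2]⟩
  have hglim : Tendsto (fun n => ∫ᵛ y, g y ∂<•(μ n)) atTop (𝓝 (∫ᵛ y, g y ∂<•μ')) := by
    simp only [hgint]
    exact tendsto_finsetSum _ fun i _ => (h _ (hxS (i + 1)) _ (hxS i)).const_mul _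
  filter_upwards [Metric.tendsto_nhds.1 hglim (η / 2) (by positivity)] with n hn
  have h1 := (happrox (μ n)).trans (mul_le_mul_of_nonneg_left (hC n) hε0.le)
  have h2 := happrox μ'
  rw [← hD] at h2
  rw [Real.dist_eq] at hn ⊢
  rw [abs_lt] at *
  rw [abs_le] at h1 h2
  constructor <;> linarith [h1.1, h1.2, h2.1, h2.2, hn.1, hn.2]

theorem ConvergesAlmostBasically.convergesVaguely {μ : ℕ → SignedMeasure ℝ}
    {μ' : SignedMeasure ℝ} (h : ConvergesAlmostBasically μ μ')
    (hb : LocallyUniformlyBoundedInVariation μ) : ConvergesVaguely μ μ' := by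
  intro f hf hfc
  refine tendsto_of_subseq_tendsto fun ns hns => ?_
  -- `ns` merely tends to infinity, whereas the hypothesis needs a strictly increasing sequence.
  obtain ⟨φ, hφ, hφ'⟩ := strictMono_subseq_of_tendsto_atTop hns
  obtain ⟨ψ, hψ, S, hS, hlim⟩ := h (ns ∘ φ) hφ'
  refine ⟨φ ∘ ψ, convergesVaguely_of_tendsto_sub (μ := fun l => μ (ns (φ (ψ l)))) ?_ hS hlim
    f hf hfc⟩
  intro r
  exact (iSup_le fun l => le_iSup (fun n => (μ n).totalVariation (Set.Icc (-r) r))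
    (ns (φ (ψ l)))).trans_lt (hb r)

/-! ### Arbitrary decompositions -/

/-- The absolute values make the hypothesis symmetric, so `ρ` can be either part of the
decomposition. -/
theorem ConvergesAlmostBasically.locallyUniformlyBounded_of_abs_sub_eq {μ : ℕ → SignedMeasure ℝ}
    {μ' : SignedMeasure ℝ} (h : ConvergesAlmostBasically μ μ') {ρ σ : ℕ → Measure ℝ}
    [∀ n, IsFiniteMeasure (ρ n)] [∀ n, IsFiniteMeasure (σ n)]
    (hρσ : ∀ n s, MeasurableSet s → |(ρ n).real s - (σ n).real s| = |μ n s|)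
    (hρ : LocallyUniformlyBounded ρ) : LocallyUniformlyBounded σ := by
  rw [locallyUniformlyBounded_iff] at hρ ⊢
  intro r
  by_contra! hunb
  -- An eventual bound would extend to all `n`, as finitely many terms are always bounded.
  have hfreq (K : ℕ) : ∃ᶠ n in atTop, (K : ℝ) < (σ n).real (Set.Icc (-r) r) := by
    intro hK
    obtain ⟨B, hB⟩ := (isBoundedUnder_of_eventually_le (a := (K : ℝ))
      (hK.mono fun n hn => not_lt.1 hn)).bddAbove_range
    obtain ⟨n, hn⟩ := hunb B
    exact hn.not_ge (hB ⟨n, rfl⟩)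
  obtain ⟨φ, hφ, hlarge⟩ := extraction_forall_of_frequently hfreq
  obtain ⟨ψ, hψ, S, hS, hlim⟩ := h φ hφ
  obtain ⟨a, ha, haS⟩ := exists_mem_Ioo_notMem_of_volume_eq_zero hS
    (show -(|r| + 1) < -|r| by linarith)
  obtain ⟨b, hb, hbS⟩ := exists_mem_Ioo_notMem_of_volume_eq_zero hS
    (show |r| < |r| + 1 by linarith)
  have hab : a ≤ b := by linarith [ha.2, hb.1, abs_nonneg r]
  obtain ⟨C, hC⟩ := hρ (|r| + 1)
  obtain ⟨B, hB⟩ := (hlim b hbS a haS).abs.bddAbove_range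
  -- Along the subsequence the `σ`-mass of `(a, b]` is at most `C + B`, yet it exceeds `ψ l ≥ l`.
  obtain ⟨l, hl⟩ := exists_nat_gt (C + B)
  have h1 := hlarge (ψ l)
  have h2 : (l : ℝ) ≤ ψ l := by exact_mod_cast hψ.le_apply
  have h3 : |distributionFunction (μ (φ (ψ l))) b - distributionFunction (μ (φ (ψ l))) a| ≤ B :=
    hB ⟨l, rfl⟩
  rw [distributionFunction_sub _ hab, ← hρσ _ _ measurableSet_Ioc, abs_le] at h3
  have h4 : (ρ (φ (ψ l))).real (Set.Ioc a b) ≤ C := by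
    refine (measureReal_mono fun y hy => ?_).trans (hC _)
    exact ⟨by linarith [hy.1, ha.1], by linarith [hy.2, hb.2]⟩
  have h5 : (σ (φ (ψ l))).real (Set.Icc (-r) r) ≤ (σ (φ (ψ l))).real (Set.Ioc a b) :=
    measureReal_mono fun y hy => ⟨by linarith [hy.1, ha.2, le_abs_self r],
      by linarith [hy.2, hb.1, le_abs_self r]⟩
  linarith [h3.1]

/-- The variation is below any measure that dominates the absolute value on every measurable set. -/
theorem totalVariation_toSignedMeasure_sub_le (ρ σ : Measure ℝ) [IsFiniteMeasure ρ]
    [IsFiniteMeasure σ] :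
    (ρ.toSignedMeasure - σ.toSignedMeasure).totalVariation ≤ ρ + σ := by
  rw [SignedMeasure.totalVariation_eq_variation]
  refine VectorMeasure.variation_le_of_forall_enorm_le fun s hs => ?_
  rw [Measure.toSignedMeasure_sub_apply hs, ← ofReal_norm, Real.norm_eq_abs, ← ofReal_measureReal]
  refine ENNReal.ofReal_le_ofReal ?_
  rw [measureReal_add_apply, abs_le]
  constructor <;> linarith [measureReal_nonneg (μ := ρ) (s := s),
    measureReal_nonneg (μ := σ) (s := s)]

theorem locallyUniformlyBoundedInVariation_of_eq_sub {μ : ℕ → SignedMeasure ℝ}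
    {ρ σ : ℕ → Measure ℝ} [∀ n, IsFiniteMeasure (ρ n)] [∀ n, IsFiniteMeasure (σ n)]
    (hμ : ∀ n, μ n = (ρ n).toSignedMeasure - (σ n).toSignedMeasure)
    (hρ : LocallyUniformlyBounded ρ) (hσ : LocallyUniformlyBounded σ) :
    LocallyUniformlyBoundedInVariation μ := by
  intro r
  refine (iSup_le fun n => ?_).trans_lt (ENNReal.add_lt_top.2 ⟨hρ r, hσ r⟩)
  beta_reduce
  rw [hμ n]
  exact (totalVariation_toSignedMeasure_sub_le (ρ n) (σ n) _).trans
    (add_le_add (le_iSup (fun n => ρ n (Set.Icc (-r) r)) n)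
      (le_iSup (fun n => σ n (Set.Icc (-r) r)) n))

theorem theorem3p12 (μ : ℕ → SignedMeasure ℝ) (μ' : SignedMeasure ℝ) :
    (ConvergesVaguely μ μ' ↔
      ConvergesBasically μ μ' ∧ LocallyUniformlyBoundedInVariation μ) ∧
    (ConvergesVaguely μ μ' ↔
      ConvergesAlmostBasically μ μ' ∧ LocallyUniformlyBoundedInVariation μ) ∧
    (∀ (μpos μneg : ℕ → Measure ℝ) [∀ n, IsFiniteMeasure (μpos n)]
        [∀ n, IsFiniteMeasure (μneg n)],
      (∀ n, μ n = (μpos n).toSignedMeasure - (μneg n).toSignedMeasure) →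
      (ConvergesBasically μ μ' ∨ ConvergesAlmostBasically μ μ') →
      (LocallyUniformlyBounded μpos ∨ LocallyUniformlyBounded μneg) →
      LocallyUniformlyBoundedInVariation μ ∧ ConvergesVaguely μ μ') := by
  refine ⟨⟨fun h => ⟨h.convergesBasically, h.locallyUniformlyBoundedInVariation⟩,
    fun h => h.1.convergesAlmostBasically.convergesVaguely h.2⟩,
    ⟨fun h => ⟨h.convergesBasically.convergesAlmostBasically,
      h.locallyUniformlyBoundedInVariation⟩, fun h => h.1.convergesVaguely h.2⟩, ?_⟩
  intro μpos μneg _ _ hμ hconv hbdd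
  have hab : ConvergesAlmostBasically μ μ' :=
    hconv.elim ConvergesBasically.convergesAlmostBasically id
  have happly (n : ℕ) (s : Set ℝ) (hs : MeasurableSet s) :
      |(μpos n).real s - (μneg n).real s| = |μ n s| := by
    rw [hμ n, Measure.toSignedMeasure_sub_apply hs]
  have hvar : LocallyUniformlyBoundedInVariation μ := by
    rcases hbdd with hpos | hneg
    · exact locallyUniformlyBoundedInVariation_of_eq_sub hμ hpos
        (hab.locallyUniformlyBounded_of_abs_sub_eq happly hpos)
    · refine locallyUniformlyBoundedInVariation_of_eq_sub hμ
        (hab.locallyUniformlyBounded_of_abs_sub_eq (fun n s hs => ?_) hneg) hneg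
      rw [abs_sub_comm]
      exact happly n s hs
  exact ⟨hvar, hab.convergesVaguely hvar⟩
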